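/- For an integer $k\ge 3$ and $x\in\mathbb{Z}$ let $$p_k(x)=(k-2)\frac{x(x-1)}{2}+x=\frac{(k-2)x^2-(k-4)x}{2}$$ be the generalized $k$-gonal number. For positive integers $a,b,c$, the sum $ap_i+bp_j+cp_k$ is called universal over $\mathbb{Z}$ if $$\{ap_i(x)+bp_j(y)+cp_k(z):\ x,y,z\in\mathbb{Z}\}=\mathbb{N}=\{0,1,2,\ldots\}.$$ **Theorem 1.1.** (i) Suppose that $ap_k+bp_k+cp_k$ is universal over $\mathbb{Z}$, where $k\in\{4,5,7,8,9,\ldots\}$ and $a,b,c$ are positive integers with $a\le b\le c$. Then $k=5$, and $(a,b,c)$ is among the following $20$ triples: $$(1,1,1),\ (1,1,2),\ (1,1,3),\ (1,1,4),\ (1,1,5),\ (1,1,6),\ (1,1,8),\ (1,1,9),\ (1,1,10),$$ $$(1,2,2),\ (1,2,3),\ (1,2,4),\ (1,2,6),\ (1,2,8),$$ $$(1,3,3),\ (1,3,4),\ (1,3,6),\ (1,3,7),\ (1,3,8),\ (1,3,9).$$ (ii) The sums $$p_5+p_5+2p_5,\quad p_5+p_5+4p_5,\quad p_5+2p_5+2p_5,\quad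 p_5+2p_5+4p_5,\quad p_5+p_5+5p_5,\quad p_5+3p_5+6p_5$$ are universal over $\mathbb{Z}$. -/

import Mathlib

/-- The generalized `m`-gonal number
`p_m(x) = (m - 2) * (x choose 2) + x = ((m - 2) x ^ 2 - (m - 4) x) / 2` at an integer `x`.
The arithmetic, including `m - 2` and `m - 4`, is in `ℤ`, and the division is exact
(`two_mul_polygonal`). -/
def polygonal (m : ℕ) (x : ℤ) : ℤ :=
  (((m : ℤ) - 2) * x ^ 2 - ((m : ℤ) - 4) * x) / 2

/-- The division in the definition of `polygonal` is exact. -/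
theorem two_mul_polygonal (m : ℕ) (x : ℤ) :
    2 * polygonal m x = ((m : ℤ) - 2) * x ^ 2 - ((m : ℤ) - 4) * x := by
  unfold polygonal
  apply Int.mul_ediv_cancel'
  obtain ⟨r, hr⟩ := (Int.even_mul_pred_self x).two_dvd
  exact ⟨((m : ℤ) - 2) * r + x, by linear_combination ((m : ℤ) - 2) * hr⟩

/-- The sum `a p_i + b p_j + c p_k` is universal over `ℤ`:
`a p_i(ℤ) + b p_j(ℤ) + c p_k(ℤ) = ℕ`, as an equality of sets of integers. -/
def UniversalOverInt (a i b j c k : ℕ) : Prop :=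
  {n : ℤ | ∃ x y z : ℤ,
      n = (a : ℤ) * polygonal i x + (b : ℤ) * polygonal j y + (c : ℤ) * polygonal k z}
    = Set.range ((↑) : ℕ → ℤ)

/-!
A generalized polygonal number satisfies `p_m(x) ≥ x²`, so whether a sum represents a given number
is a finite check. For `m ≥ 12` the only values up to `8` are `0` and `1`, so a sum takes at most
seven positive values up to `8`. For smaller `m`, the first numbers missed by one or two of the
terms bound the coefficients, and each remaining triple outside the list misses a number that is at
most `131`.

For the six universal sums, `24 p₅(x) + 1 = (6x - 1)²` turns the claim into the representation of
`24n + a + b + c` by `a X² + b Y² + c Z²` with `X, Y, Z` prime to `6`. Without the coprimality this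
follows from two facts: a number that is `1` or `2` modulo `4`, or `3` modulo `8`, is a sum of three
squares (`sum_three_squares`), and a number that is `7` modulo `8` is of the form `x² + y² + 5z²`
(`exists_sq_add_sq_add_five_mul_sq`). Congruences modulo `8` then make the variables odd, and
divisibility by `3` is repaired with the elements of norm `9` in `ℤ[√-2]` and `ℤ[√-5]`
(`exists_not_both_dvd_three`) and with a reflection
(`exists_three_squares_not_all_dvd_three`).

Both facts are proved through reduction theory. A positive definite ternary form of determinant `1`
is equivalent to the sum of three squares (`representsForm_of_det_one`). One of determinant `5` is
equivalent to `x² + y² + 5z²` or to `x² + 2y² + 2yz + 3z²`, and the binary minors modulo `5` exclude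
the latter (`representsForm_of_det_five_of_minor`). It remains to find a form of determinant `D`
that takes the value `N`. It exists when `-b` is a square modulo `q = bN - D` for some `b > 0`
(`exists_ternaryGram`). Dirichlet's theorem supplies `b` with `q` a prime or twice a prime, and
quadratic reciprocity shows that `-b` is a square modulo `q`.
-/

/-! ### Coefficients of universal sums -/

theorem sq_le_polygonal {m : ℕ} (hm : 4 ≤ m) (x : ℤ) : x ^ 2 ≤ polygonal m x := by
  have h := two_mul_polygonal m x
  have hm' : (4 : ℤ) ≤ m := by exact_mod_cast hm
  have hx : 0 ≤ x ^ 2 - x := by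
    rcases le_or_gt x 0 with h0 | h0 <;> nlinarith
  nlinarith [mul_nonneg (sub_nonneg.2 hm') hx]

theorem polygonal_eq_or_ge {m : ℕ} (hm : 4 ≤ m) (x : ℤ) :
    polygonal m x = 0 ∨ polygonal m x = 1 ∨ (m : ℤ) - 3 ≤ polygonal m x := by
  have h := two_mul_polygonal m x
  have hm' : (4 : ℤ) ≤ m := by exact_mod_cast hm
  rcases lt_trichotomy x 0 with hx | rfl | hx
  · right; right
    nlinarith [mul_nonneg (sub_nonneg.2 hm') (mul_nonneg (neg_nonneg.2 hx.le)
      (by linarith : 0 ≤ -x - 1)), mul_nonneg (neg_nonneg.2 hx.le) (by linarith : 0 ≤ -x - 1)]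
  · left; linarith
  · rcases (show x = 1 ∨ 2 ≤ x by omega) with rfl | hx2
    · right; left; linarith
    · right; right
      nlinarith [mul_nonneg (sub_nonneg.2 hm') (mul_nonneg (by linarith : 0 ≤ x - 2)
        (by linarith : 0 ≤ x + 1))]

/-- A natural number below `(s + 1) ^ 2` which is `a p_m(x) + b p_m(y) + c p_m(z)` is so with
`x, y, z` in `[-s, s]`, and the terms whose coefficient exceeds the number may be dropped. -/
theorem UniversalOverInt.exists_bounded {a b c m : ℕ} (hm : 4 ≤ m)
    (h : UniversalOverInt a m b m c m) (n s : ℕ) (hs : n < (s + 1) ^ 2) :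
    ∃ x ∈ Finset.Icc (-s : ℤ) s, ∃ y ∈ Finset.Icc (-s : ℤ) s, ∃ z ∈ Finset.Icc (-s : ℤ) s,
      (n : ℤ) = (if n < a then 0 else (a : ℤ)) * polygonal m x
        + (if n < b then 0 else (b : ℤ)) * polygonal m y
        + (if n < c then 0 else (c : ℤ)) * polygonal m z := by
  have hn : (n : ℤ) ∈ Set.range ((↑) : ℕ → ℤ) := ⟨n, rfl⟩
  rw [← h] at hn
  obtain ⟨x, y, z, hxyz⟩ := hn
  have nonneg : ∀ (d : ℕ) (w : ℤ), 0 ≤ (d : ℤ) * polygonal m w := fun d w =>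
    mul_nonneg (Int.natCast_nonneg d) ((sq_nonneg w).trans (sq_le_polygonal hm w))
  have key : ∀ (d : ℕ) (w : ℤ), (d : ℤ) * polygonal m w ≤ n →
      ∃ w' ∈ Finset.Icc (-s : ℤ) s,
        (if n < d then 0 else (d : ℤ)) * polygonal m w' = d * polygonal m w := by
    intro d w hw
    have hp := sq_le_polygonal hm w
    rcases Nat.eq_zero_or_pos d with rfl | hd
    · exact ⟨0, by simp, by simp⟩
    have hd' : (1 : ℤ) ≤ d := by exact_mod_cast hd
    split_ifs with hdn
    · refine ⟨0, by simp, ?_⟩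
      have hdn' : (n : ℤ) < d := by exact_mod_cast hdn
      have : polygonal m w = 0 := by
        by_contra hne
        have : 1 ≤ polygonal m w := by
          have := sq_nonneg w
          omega
        nlinarith
      simp [this]
    · refine ⟨w, ?_, rfl⟩
      have hs' : (n : ℤ) < (s + 1) ^ 2 := by exact_mod_cast hs
      have h2 : w ^ 2 < ((s : ℤ) + 1) ^ 2 := by nlinarith [sq_nonneg w]
      have := abs_lt_of_sq_lt_sq' h2 (by positivity)
      rw [Finset.mem_Icc]
      omega
  have h1 := nonneg a x
  have h2 := nonneg b y
  have h3 := nonneg c z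
  obtain ⟨x', hx', ex⟩ := key a x (by linarith)
  obtain ⟨y', hy', ey⟩ := key b y (by linarith)
  obtain ⟨z', hz', ez⟩ := key c z (by linarith)
  exact ⟨x', hx', y', hy', z', hz', by rw [ex, ey, ez]; exact hxyz⟩

/-- The least coefficient of a universal sum is `1`, as the sum represents `1`. -/
theorem UniversalOverInt.coeff_le_one {a b c m : ℕ} (hm : 4 ≤ m) (hab : a ≤ b) (hbc : b ≤ c)
    (h : UniversalOverInt a m b m c m) : a ≤ 1 := by
  by_contra! ha
  obtain ⟨x, -, y, -, z, -, e⟩ := h.exists_bounded hm 1 1 (by norm_num)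
  rw [if_pos (by omega), if_pos (by omega), if_pos (by omega)] at e
  norm_num at e

/-- A universal sum of large polygonal numbers is impossible: up to `8` each term is `0` or its
coefficient, which gives at most seven positive values. -/
theorem not_universalOverInt_of_twelve_le {a b c m : ℕ} (hm : 12 ≤ m) (ha : 1 ≤ a) (hab : a ≤ b)
    (hbc : b ≤ c) : ¬ UniversalOverInt a m b m c m := by
  intro h
  have key : ∀ n : ℕ, n ≤ 8 → ∃ e f g : ℤ, (e = 0 ∨ e = a) ∧ (f = 0 ∨ f = b) ∧ (g = 0 ∨ g = c) ∧
      (n : ℤ) = e + f + g := by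
    intro n hn
    have hn' : (n : ℤ) ∈ Set.range ((↑) : ℕ → ℤ) := ⟨n, rfl⟩
    rw [← h] at hn'
    obtain ⟨x, y, z, hxyz⟩ := hn'
    have nonneg : ∀ (d : ℕ) (w : ℤ), 0 ≤ (d : ℤ) * polygonal m w := fun d w =>
      mul_nonneg (Int.natCast_nonneg d)
        ((sq_nonneg w).trans (sq_le_polygonal (by omega) w))
    have term : ∀ (d : ℕ) (w : ℤ), 1 ≤ d → (d : ℤ) * polygonal m w ≤ n →
        (d : ℤ) * polygonal m w = 0 ∨ (d : ℤ) * polygonal m w = d := by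
      intro d w hd hw
      rcases polygonal_eq_or_ge (m := m) (by omega) w with h0 | h1 | h2
      · simp [h0]
      · simp [h1]
      · exfalso
        have hd' : (1 : ℤ) ≤ d := by exact_mod_cast hd
        have hm' : (12 : ℤ) ≤ m := by exact_mod_cast hm
        have hn'' : (n : ℤ) ≤ 8 := by exact_mod_cast hn
        nlinarith
    have h1 := nonneg a x
    have h2 := nonneg b y
    have h3 := nonneg c z
    exact ⟨_, _, _, term a x ha (by linarith), term b y (by omega) (by linarith),
      term c z (by omega) (by linarith), hxyz⟩
  have ha1 := h.coeff_le_one (by omega) hab hbc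
  have hb2 : b ≤ 2 := by
    obtain ⟨e, f, g, he, hf, hg, E⟩ := key 2 (by norm_num)
    omega
  have hc4 : c ≤ 4 := by
    obtain ⟨e, f, g, he, hf, hg, E⟩ := key 3 (by norm_num)
    obtain ⟨e', f', g', he', hf', hg', E'⟩ := key 4 (by norm_num)
    omega
  obtain ⟨e, f, g, he, hf, hg, E⟩ := key 8 (by norm_num)
  omega

/-- For `m ≤ 11` other than `5` and `6`, some number up to `131` is missed, whatever the
coefficients. -/
theorem not_universalOverInt_of_le_eleven {a b c m : ℕ} (hm : 4 ≤ m) (hm5 : m ≠ 5) (hm6 : m ≠ 6)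
    (hm11 : m ≤ 11) (ha : 1 ≤ a) (hab : a ≤ b) (hbc : b ≤ c) :
    ¬ UniversalOverInt a m b m c m := by
  intro h
  obtain rfl : a = 1 := le_antisymm (h.coeff_le_one hm hab hbc) ha
  have hb2 : b ≤ 2 := by
    by_contra! hb
    have := h.exists_bounded hm 2 1 (by norm_num)
    rw [if_neg (by omega), if_pos (by omega), if_pos (by omega)] at this
    clear h
    interval_cases m <;> first | omega | (revert this; decide +kernel)
  interval_cases b
  · have hc : c ≤ 3 := by
      by_contra! hc
      have := h.exists_bounded hm 3 1 (by norm_num)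
      rw [if_pos (show 3 < c by omega)] at this
      clear h
      interval_cases m <;> first | omega | (revert this; decide +kernel)
    have h4 := h.exists_bounded hm 4 2 (by norm_num)
    have h5 := h.exists_bounded hm 5 2 (by norm_num)
    have h6 := h.exists_bounded hm 6 2 (by norm_num)
    have h7 := h.exists_bounded hm 7 2 (by norm_num)
    have h8 := h.exists_bounded hm 8 2 (by norm_num)
    have h10 := h.exists_bounded hm 10 3 (by norm_num)
    have h14 := h.exists_bounded hm 14 3 (by norm_num)
    have h23 := h.exists_bounded hm 23 4 (by norm_num)
    clear h
    interval_cases m <;> first | omega | interval_cases c <;> first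
      | (revert h4; decide +kernel) | (revert h5; decide +kernel) | (revert h6; decide +kernel)
      | (revert h7; decide +kernel) | (revert h8; decide +kernel) | (revert h10; decide +kernel)
      | (revert h14; decide +kernel) | (revert h23; decide +kernel)
  · have hc : c ≤ 5 := by
      by_contra! hc
      have := h.exists_bounded hm 5 2 (by norm_num)
      have h4 := h.exists_bounded hm 4 2 (by norm_num)
      simp only [if_pos (show 4 < c by omega), if_pos (show 5 < c by omega)] at this h4
      clear h
      interval_cases m <;> first
        | omega
        | (revert this; decide +kernel)
        | (revert h4; decide +kernel)
    have h4 := h.exists_bounded hm 4 2 (by norm_num)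
    have h6 := h.exists_bounded hm 6 2 (by norm_num)
    have h7 := h.exists_bounded hm 7 2 (by norm_num)
    have h8 := h.exists_bounded hm 8 2 (by norm_num)
    have h9 := h.exists_bounded hm 9 3 (by norm_num)
    have h10 := h.exists_bounded hm 10 3 (by norm_num)
    have h13 := h.exists_bounded hm 13 3 (by norm_num)
    have h14 := h.exists_bounded hm 14 3 (by norm_num)
    have h19 := h.exists_bounded hm 19 4 (by norm_num)
    have h31 := h.exists_bounded hm 31 5 (by norm_num)
    have h131 := h.exists_bounded hm 131 11 (by norm_num)
    clear h
    interval_cases m <;> first | omega | interval_cases c <;> first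
      | (revert h4; decide +kernel) | (revert h6; decide +kernel) | (revert h7; decide +kernel)
      | (revert h8; decide +kernel) | (revert h9; decide +kernel) | (revert h10; decide +kernel)
      | (revert h13; decide +kernel) | (revert h14; decide +kernel)
      | (revert h19; decide +kernel) | (revert h31; decide +kernel)
      | (revert h131; decide +kernel)

theorem UniversalOverInt.pentagonal_coeff_mem {a b c : ℕ} (ha : 1 ≤ a) (hab : a ≤ b) (hbc : b ≤ c)
    (h : UniversalOverInt a 5 b 5 c 5) :
    (a, b, c) ∈ ({(1, 1, 1), (1, 1, 2), (1, 1, 3), (1, 1, 4), (1, 1, 5), (1, 1, 6),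
      (1, 1, 8), (1, 1, 9), (1, 1, 10),
      (1, 2, 2), (1, 2, 3), (1, 2, 4), (1, 2, 6), (1, 2, 8),
      (1, 3, 3), (1, 3, 4), (1, 3, 6), (1, 3, 7), (1, 3, 8), (1, 3, 9)} :
      Set (ℕ × ℕ × ℕ)) := by
  have hm : 4 ≤ 5 := by norm_num
  obtain rfl : a = 1 := le_antisymm (h.coeff_le_one hm hab hbc) ha
  have hb3 : b ≤ 3 := by
    by_contra! hb
    have := h.exists_bounded hm 3 1 (by norm_num)
    rw [if_neg (by omega), if_pos (by omega), if_pos (by omega)] at this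
    revert this; decide +kernel
  interval_cases b
  · have hc : c ≤ 11 := by
      by_contra! hc
      have := h.exists_bounded hm 11 3 (by norm_num)
      rw [if_pos (show 11 < c by omega)] at this
      revert this; decide +kernel
    have h25 := h.exists_bounded hm 25 5 (by norm_num)
    have h43 := h.exists_bounded hm 43 6 (by norm_num)
    clear h
    interval_cases c <;> first
      | (simp; done)
      | (revert h25; decide +kernel)
      | (revert h43; decide +kernel)
  · have hc : c ≤ 8 := by
      by_contra! hc
      have := h.exists_bounded hm 8 2 (by norm_num)
      rw [if_pos (show 8 < c by omega)] at this
      revert this; decide +kernel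
    have h18 := h.exists_bounded hm 18 4 (by norm_num)
    have h27 := h.exists_bounded hm 27 5 (by norm_num)
    clear h
    interval_cases c <;> first
      | (simp; done)
      | (revert h18; decide +kernel)
      | (revert h27; decide +kernel)
  · have hc : c ≤ 9 := by
      by_contra! hc
      have := h.exists_bounded hm 9 3 (by norm_num)
      rw [if_pos (show 9 < c by omega)] at this
      revert this; decide +kernel
    have h19 := h.exists_bounded hm 19 4 (by norm_num)
    clear h
    interval_cases c <;> first | (simp; done) | (revert h19; decide +kernel)

/-! ### Reduction of positive definite ternary forms -/

/-- The symmetric matrix of the integral ternary form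
`a x² + b y² + c z² + 2 r y z + 2 s x z + 2 t x y`. -/
def ternaryGram (a b c r s t : ℤ) : Matrix (Fin 3) (Fin 3) ℤ :=
  !![a, t, s; t, b, r; s, r, c]

/-- `RepresentsForm G F`: the form `F` arises from `G` by an integral linear substitution, so that
`G` takes all values that `F` takes. The substitution need not be invertible. -/
def RepresentsForm (G F : Matrix (Fin 3) (Fin 3) ℤ) : Prop :=
  ∃ T : Matrix (Fin 3) (Fin 3) ℤ, F = T.transpose * G * T

theorem RepresentsForm.trans {F G H : Matrix (Fin 3) (Fin 3) ℤ} (h₁ : RepresentsForm H G)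
    (h₂ : RepresentsForm G F) : RepresentsForm H F := by
  obtain ⟨T, rfl⟩ := h₁
  obtain ⟨S, rfl⟩ := h₂
  exact ⟨T * S, by simp only [Matrix.transpose_mul, Matrix.mul_assoc]⟩

/-- `RepresentsForm` in coordinates: `p`, `q`, `u` are the images of the basis vectors. -/
theorem representsForm_ternaryGram {a b c r s t a' b' c' r' s' t' : ℤ}
    (p q u : Fin 3 → ℤ)
    (ha : a = a' * p 0 ^ 2 + b' * p 1 ^ 2 + c' * p 2 ^ 2
      + 2 * r' * p 1 * p 2 + 2 * s' * p 0 * p 2 + 2 * t' * p 0 * p 1)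
    (hb : b = a' * q 0 ^ 2 + b' * q 1 ^ 2 + c' * q 2 ^ 2
      + 2 * r' * q 1 * q 2 + 2 * s' * q 0 * q 2 + 2 * t' * q 0 * q 1)
    (hc : c = a' * u 0 ^ 2 + b' * u 1 ^ 2 + c' * u 2 ^ 2
      + 2 * r' * u 1 * u 2 + 2 * s' * u 0 * u 2 + 2 * t' * u 0 * u 1)
    (hr : r = a' * q 0 * u 0 + b' * q 1 * u 1 + c' * q 2 * u 2 + r' * (q 1 * u 2 + q 2 * u 1)
      + s' * (q 0 * u 2 + q 2 * u 0) + t' * (q 0 * u 1 + q 1 * u 0))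
    (hs : s = a' * p 0 * u 0 + b' * p 1 * u 1 + c' * p 2 * u 2 + r' * (p 1 * u 2 + p 2 * u 1)
      + s' * (p 0 * u 2 + p 2 * u 0) + t' * (p 0 * u 1 + p 1 * u 0))
    (ht : t = a' * p 0 * q 0 + b' * p 1 * q 1 + c' * p 2 * q 2 + r' * (p 1 * q 2 + p 2 * q 1)
      + s' * (p 0 * q 2 + p 2 * q 0) + t' * (p 0 * q 1 + p 1 * q 0)) :
    RepresentsForm (ternaryGram a' b' c' r' s' t') (ternaryGram a b c r s t) := by
  refine ⟨!![p 0, q 0, u 0; p 1, q 1, u 1; p 2, q 2, u 2], ?_⟩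
  ext i j
  subst ha hb hc hr hs ht
  fin_cases i <;> fin_cases j <;>
    simp [ternaryGram, Matrix.mul_apply, Fin.sum_univ_three] <;> ring

/-- The values of the representing form at the images of the basis vectors, and its inner product
of the first two. -/
theorem RepresentsForm.exists_vectors {a b c r s t a' b' c' r' s' t' : ℤ}
    (h : RepresentsForm (ternaryGram a' b' c' r' s' t') (ternaryGram a b c r s t)) :
    ∃ p q u : Fin 3 → ℤ,
      a = a' * p 0 ^ 2 + b' * p 1 ^ 2 + c' * p 2 ^ 2
        + 2 * r' * p 1 * p 2 + 2 * s' * p 0 * p 2 + 2 * t' * p 0 * p 1 ∧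
      b = a' * q 0 ^ 2 + b' * q 1 ^ 2 + c' * q 2 ^ 2
        + 2 * r' * q 1 * q 2 + 2 * s' * q 0 * q 2 + 2 * t' * q 0 * q 1 ∧
      c = a' * u 0 ^ 2 + b' * u 1 ^ 2 + c' * u 2 ^ 2
        + 2 * r' * u 1 * u 2 + 2 * s' * u 0 * u 2 + 2 * t' * u 0 * u 1 ∧
      t = a' * p 0 * q 0 + b' * p 1 * q 1 + c' * p 2 * q 2 + r' * (p 1 * q 2 + p 2 * q 1)
        + s' * (p 0 * q 2 + p 2 * q 0) + t' * (p 0 * q 1 + p 1 * q 0) := by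
  obtain ⟨T, hT⟩ := h
  refine ⟨fun i => T i 0, fun i => T i 1, fun i => T i 2, ?_, ?_, ?_, ?_⟩
  · have := congrFun (congrFun hT 0) 0
    simp [ternaryGram, Matrix.mul_apply, Fin.sum_univ_three] at this
    rw [this]; ring
  · have := congrFun (congrFun hT 1) 1
    simp [ternaryGram, Matrix.mul_apply, Fin.sum_univ_three] at this
    rw [this]; ring
  · have := congrFun (congrFun hT 2) 2
    simp [ternaryGram, Matrix.mul_apply, Fin.sum_univ_three] at this
    rw [this]; ring
  · have := congrFun (congrFun hT 0) 1
    simp [ternaryGram, Matrix.mul_apply, Fin.sum_univ_three] at this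
    rw [this]; ring

theorem exists_abs_two_mul_add_le (B : ℤ) {m : ℤ} (hm : 0 < m) : ∃ k : ℤ, |2 * (B + k * m)| ≤ m := by
  refine ⟨-((2 * B + m) / (2 * m)), ?_⟩
  have h1 := Int.mul_ediv_add_emod (2 * B + m) (2 * m)
  have h2 := Int.emod_nonneg (2 * B + m) (by omega : 2 * m ≠ 0)
  have h3 := Int.emod_lt_of_pos (2 * B + m) (by omega : 0 < 2 * m)
  rw [abs_le]
  constructor <;> linarith

/-- The determinant of `ternaryGram a b c r s t`. -/
def ternaryDet (a b c r s t : ℤ) : ℤ :=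
  a * b * c + 2 * r * s * t - a * r ^ 2 - b * s ^ 2 - c * t ^ 2

theorem exists_sizeReduced {a b c r s t : ℤ} (ha : 0 < a) (hm : 0 < a * b - t ^ 2) :
    ∃ b' c' r' s' t' : ℤ,
      RepresentsForm (ternaryGram a b' c' r' s' t') (ternaryGram a b c r s t) ∧
      a * b' - t' ^ 2 = a * b - t ^ 2 ∧
      ternaryDet a b' c' r' s' t' = ternaryDet a b c r s t ∧
      |2 * t'| ≤ a ∧ |2 * s'| ≤ a ∧ |2 * (a * r' - s' * t')| ≤ a * b' - t' ^ 2 := by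
  obtain ⟨k, hk⟩ := exists_abs_two_mul_add_le (a * r - s * t) hm
  obtain ⟨l, hl⟩ := exists_abs_two_mul_add_le t ha
  obtain ⟨j, hj⟩ := exists_abs_two_mul_add_le (s + k * t) ha
  -- The basis `e₁, e₂ + l e₁, e₃ + k e₂ + j e₁`.
  refine ⟨b + 2 * l * t + l ^ 2 * a,
    c + k ^ 2 * b + j ^ 2 * a + 2 * k * r + 2 * j * s + 2 * k * j * t,
    r + k * b + j * t + l * (s + k * t + j * a), s + k * t + j * a, t + l * a, ?_, ?_, ?_, hl, hj, ?_⟩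
  · apply representsForm_ternaryGram ![1, 0, 0] ![-l, 1, 0] ![k * l - j, -k, 1] <;> simp <;> ring
  · ring
  · unfold ternaryDet; ring
  · have e₁ : a * (b + 2 * l * t + l ^ 2 * a) - (t + l * a) ^ 2 = a * b - t ^ 2 := by ring
    have e₂ : a * (r + k * b + j * t + l * (s + k * t + j * a)) - (s + k * t + j * a) * (t + l * a)
        = a * r - s * t + k * (a * b - t ^ 2) := by ring
    rw [e₁, e₂]
    exact hk

/-- Every positive definite integral ternary form is equivalent to a reduced one: the first basis
vector is not longer than the second, the binary form `a F - (a x + t y + s z)²` is reduced, and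
the off-diagonal entries are small. The descent is on `(a, a b - t²)`, lexicographically. -/
theorem exists_reduced (a b c r s t : ℤ) (ha : 0 < a) (hm : 0 < a * b - t ^ 2)
    (hD : 0 < ternaryDet a b c r s t) :
    ∃ a' b' c' r' s' t' : ℤ,
      RepresentsForm (ternaryGram a' b' c' r' s' t') (ternaryGram a b c r s t) ∧
      0 < a' ∧ 0 < a' * b' - t' ^ 2 ∧ ternaryDet a' b' c' r' s' t' = ternaryDet a b c r s t ∧
      |2 * t'| ≤ a' ∧ |2 * s'| ≤ a' ∧ |2 * (a' * r' - s' * t')| ≤ a' * b' - t' ^ 2 ∧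
      a' ≤ b' ∧ a' * b' - t' ^ 2 ≤ a' * c' - s' ^ 2 := by
  obtain ⟨b₁, c₁, r₁, s₁, t₁, hR, hm₁, hD₁, ht, hs, hB⟩ :=
    exists_sizeReduced (c := c) (r := r) (s := s) ha hm
  have hm₁' : 0 < a * b₁ - t₁ ^ 2 := hm₁ ▸ hm
  by_cases hab : b₁ < a
  · have hb₁ : 0 < b₁ := by
      by_contra! hb
      nlinarith [sq_nonneg t₁]
    have hDs : ternaryDet b₁ a c₁ s₁ r₁ t₁ = ternaryDet a b c r s t := by
      rw [← hD₁]; unfold ternaryDet; ring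
    obtain ⟨a', b', c', r', s', t', h, h'⟩ := exists_reduced b₁ a c₁ s₁ r₁ t₁ hb₁
      (by linarith) (by rw [hDs]; exact hD)
    rw [hDs] at h'
    refine ⟨a', b', c', r', s', t', h.trans (RepresentsForm.trans ?_ hR), h'⟩
    apply representsForm_ternaryGram ![0, 1, 0] ![1, 0, 0] ![0, 0, 1] <;> simp
  by_cases hmc : a * c₁ - s₁ ^ 2 < a * b₁ - t₁ ^ 2
  · have hc₁ : 0 < a * c₁ - s₁ ^ 2 := by
      have key : (a * b₁ - t₁ ^ 2) * (a * c₁ - s₁ ^ 2)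
          = (a * r₁ - s₁ * t₁) ^ 2 + a * ternaryDet a b c r s t := by
        rw [← hD₁]; unfold ternaryDet; ring
      have : 0 < (a * b₁ - t₁ ^ 2) * (a * c₁ - s₁ ^ 2) := by
        rw [key]; positivity
      exact (pos_iff_pos_of_mul_pos this).1 hm₁'
    have hDs : ternaryDet a c₁ b₁ r₁ t₁ s₁ = ternaryDet a b c r s t := by
      rw [← hD₁]; unfold ternaryDet; ring
    obtain ⟨a', b', c', r', s', t', h, h'⟩ := exists_reduced a c₁ b₁ r₁ t₁ s₁ ha hc₁
      (by rw [hDs]; exact hD)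
    rw [hDs] at h'
    refine ⟨a', b', c', r', s', t', h.trans (RepresentsForm.trans ?_ hR), h'⟩
    apply representsForm_ternaryGram ![1, 0, 0] ![0, 0, 1] ![0, 1, 0] <;> simp
  exact ⟨a, b₁, c₁, r₁, s₁, t₁, hR, ha, hm₁', hD₁, ht, hs, hB, not_lt.1 hab, not_lt.1 hmc⟩
termination_by (a.toNat, (a * b - t ^ 2).toNat)
decreasing_by
  · apply Prod.Lex.left; omega
  · apply Prod.Lex.right; omega

/-- Hermite's bounds for a reduced positive definite form of determinant `D`. -/
theorem reduced_bounds {a b c r s t D : ℤ} (ha : 0 < a) (hm : 0 < a * b - t ^ 2)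
    (hD : ternaryDet a b c r s t = D) (ht : |2 * t| ≤ a)
    (hB : |2 * (a * r - s * t)| ≤ a * b - t ^ 2) (hab : a ≤ b)
    (hmc : a * b - t ^ 2 ≤ a * c - s ^ 2) :
    3 * a ^ 2 ≤ 4 * (a * b - t ^ 2) ∧ 3 * (a * b - t ^ 2) ^ 2 ≤ 4 * (a * D) := by
  have key : (a * b - t ^ 2) * (a * c - s ^ 2) = (a * r - s * t) ^ 2 + a * D := by
    rw [← hD]; unfold ternaryDet; ring
  have h1 := sq_le_sq' (abs_le.1 ht).1 (abs_le.1 ht).2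
  have h2 := sq_le_sq' (abs_le.1 hB).1 (abs_le.1 hB).2
  constructor
  · nlinarith
  · nlinarith

/-- The sum of three squares is the only positive definite integral ternary form of
determinant `1`. -/
theorem representsForm_of_det_one {a b c r s t : ℤ} (ha : 0 < a) (hm : 0 < a * b - t ^ 2)
    (hdet : ternaryDet a b c r s t = 1) :
    RepresentsForm (ternaryGram 1 1 1 0 0 0) (ternaryGram a b c r s t) := by
  obtain ⟨a, b, c, r, s, t, hR, ha, hm, hD, ht, hs, hB, hab, hmc⟩ :=
    exists_reduced a b c r s t ha hm (by rw [hdet]; norm_num)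
  rw [hdet] at hD
  obtain ⟨h1, h2⟩ := reduced_bounds ha hm hD ht hB hab hmc
  have ha1 : a = 1 := by
    have : a < 2 := by
      by_contra! h
      have h3 : 3 * a * a ≤ 4 * (a * b - t ^ 2) := by nlinarith
      nlinarith
    omega
  subst ha1
  rw [abs_le] at ht hs
  obtain rfl : t = 0 := by omega
  obtain rfl : s = 0 := by omega
  have hb : b = 1 := by
    have : b < 2 := by
      by_contra! h
      nlinarith
    omega
  subst hb
  rw [abs_le] at hB
  norm_num at hB
  obtain rfl : r = 0 := by omega
  norm_num [ternaryDet] at hD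
  subst hD
  exact hR

/-- A positive definite integral ternary form of determinant `5` is equivalent to
`x² + y² + 5z²` or to `x² + 2y² + 2yz + 3z²`. -/
theorem representsForm_of_det_five {a b c r s t : ℤ} (ha : 0 < a) (hm : 0 < a * b - t ^ 2)
    (hdet : ternaryDet a b c r s t = 5) :
    RepresentsForm (ternaryGram 1 1 5 0 0 0) (ternaryGram a b c r s t) ∨
      RepresentsForm (ternaryGram 1 2 3 1 0 0) (ternaryGram a b c r s t) := by
  obtain ⟨a, b, c, r, s, t, hR, ha, hm, hD, ht, hs, hB, hab, hmc⟩ :=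
    exists_reduced a b c r s t ha hm (by rw [hdet]; norm_num)
  rw [hdet] at hD
  obtain ⟨h1, h2⟩ := reduced_bounds ha hm hD ht hB hab hmc
  have ha2 : a < 3 := by
    by_contra! h
    have h3 : 9 * a ≤ 4 * (a * b - t ^ 2) := by nlinarith
    nlinarith
  have key : (a * b - t ^ 2) * (a * c - s ^ 2) = (a * r - s * t) ^ 2 + a * 5 := by
    rw [← hD]; unfold ternaryDet; ring
  rw [abs_le] at ht hs
  obtain rfl | rfl : a = 1 ∨ a = 2 := by omega
  · obtain rfl : t = 0 := by omega
    obtain rfl : s = 0 := by omega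
    have hb : b < 3 := by
      by_contra! h
      nlinarith
    rw [abs_le] at hB
    norm_num at hB
    norm_num at key hm
    obtain rfl | rfl : b = 1 ∨ b = 2 := by omega
    · obtain rfl : r = 0 := by omega
      obtain rfl : c = 5 := by linarith
      exact Or.inl hR
    · obtain rfl | rfl | rfl : r = 0 ∨ r = 1 ∨ r = -1 := by omega
      · omega
      · obtain rfl : c = 3 := by linarith
        exact Or.inr hR
      · obtain rfl : c = 3 := by linarith
        refine Or.inr (RepresentsForm.trans ?_ hR)
        apply representsForm_ternaryGram ![1, 0, 0] ![0, 1, 0] ![0, 0, -1] <;> simp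
  · -- Here `2b - t² = 3`, so `3 (2c - s²) = (2r - st)² + 10`, which is impossible modulo `3`.
    exfalso
    have hm3 : 2 * b - t ^ 2 = 3 := by
      have : 2 * b - t ^ 2 < 4 := by
        by_contra! h
        nlinarith
      omega
    rw [hm3, abs_le] at hB
    rw [hm3] at key
    obtain h | h | h : 2 * r - s * t = 0 ∨ 2 * r - s * t = 1 ∨ 2 * r - s * t = -1 := by omega
    all_goals rw [h] at key; omega

/-- The forms `x² + y² + 5z²` and `x² + 2y² + 2yz + 3z²` lie in different genera: modulo `5` the
binary minors of the second are twice a square. -/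
theorem representsForm_of_det_five_of_minor {a b c r s t : ℤ} (ha : 0 < a)
    (hm : 0 < a * b - t ^ 2) (hD : ternaryDet a b c r s t = 5) (h5 : (a * b - t ^ 2) % 5 = 1) :
    RepresentsForm (ternaryGram 1 1 5 0 0 0) (ternaryGram a b c r s t) := by
  refine (representsForm_of_det_five ha hm hD).resolve_right fun h => ?_
  obtain ⟨p, q, -, hp, hq, -, ht⟩ := h.exists_vectors
  have key : a * b - t ^ 2 = 2 * ((p 0 * q 1 - p 1 * q 0) + 2 * (p 2 * q 0 - p 0 * q 2)) ^ 2
      + 5 * ((p 1 * q 2 - p 2 * q 1) ^ 2 - (p 2 * q 0 - p 0 * q 2) ^ 2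
        - 2 * (p 0 * q 1 - p 1 * q 0) * (p 2 * q 0 - p 0 * q 2)) := by
    rw [hp, hq, ht]; ring
  generalize (p 0 * q 1 - p 1 * q 0) + 2 * (p 2 * q 0 - p 0 * q 2) = w at key
  have hw : w ^ 2 % 5 = 0 ∨ w ^ 2 % 5 = 1 ∨ w ^ 2 % 5 = 4 := by
    have : w % 5 = 0 ∨ w % 5 = 1 ∨ w % 5 = 2 ∨ w % 5 = 3 ∨ w % 5 = 4 := by omega
    rcases this with h | h | h | h | h <;> simp [pow_two, Int.mul_emod, h]
  omega

/-! ### Three squares and `x² + y² + 5z²` -/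

open NumberTheorySymbols in
/-- If `2p = bN - D` with `p` an odd prime and `b` odd, then the Jacobi symbol of `-b` modulo `p`
reduces to that of `-D` modulo `b`. -/
theorem jacobiSym_neg_of_two_mul_add {p b N D : ℕ} (hp : p % 2 = 1) (hb : b % 2 = 1)
    (hpb : p % 4 = 1 ∨ b % 4 = 3) (h : 2 * p + D = b * N) :
    J(-b | p) = J(2 | b) * J(-D | b) := by
  have hpo : Odd p := Nat.odd_iff.2 hp
  have hbo : Odd b := Nat.odd_iff.2 hb
  have h1 : J(-b | p) = J(p | b) := by
    rw [jacobiSym.neg _ hpo]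
    rcases (show p % 4 = 1 ∨ p % 4 = 3 by omega) with h4 | h4
    · rw [ZMod.χ₄_nat_one_mod_four h4, one_mul, jacobiSym.quadratic_reciprocity_one_mod_four' hbo h4]
    · have hb3 : b % 4 = 3 := by omega
      rw [ZMod.χ₄_nat_three_mod_four h4, jacobiSym.quadratic_reciprocity_three_mod_four hb3 h4]
      ring
  have h2 : J(2 | b) * J(p | b) = J(-D | b) := by
    rw [← jacobiSym.mul_left]
    apply jacobiSym.mod_left'
    have : (2 * p : ℤ) = -D + b * N := by
      have : (2 * p + D : ℤ) = b * N := by exact_mod_cast h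
      linarith
    rw [this, Int.add_mul_emod_self_left]
  have h3 : J(2 | b) * J(2 | b) = 1 := by
    rw [← pow_two]
    apply jacobiSym.sq_one
    simpa [Int.gcd_eq_natAbs] using hbo.coprime_two_left
  rw [h1, ← h2, ← mul_assoc, h3, one_mul]

open NumberTheorySymbols in
theorem exists_dvd_sq_add_of_jacobiSym {p b : ℕ} (hp : p.Prime) (h : J(-b | p) = 1) :
    ∃ t : ℤ, (p : ℤ) ∣ t ^ 2 + b := by
  have : Fact p.Prime := ⟨hp⟩
  obtain ⟨r, hr⟩ := ZMod.isSquare_of_jacobiSym_eq_one h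
  obtain ⟨t, rfl⟩ := ZMod.intCast_surjective r
  refine ⟨t, ?_⟩
  rw [← ZMod.intCast_zmod_eq_zero_iff_dvd]
  push_cast at hr ⊢
  rw [pow_two, ← hr]
  ring

theorem exists_two_mul_dvd_sq_add {p b : ℕ} (hp : p % 2 = 1) (hb : b % 2 = 1)
    (h : ∃ t : ℤ, (p : ℤ) ∣ t ^ 2 + b) : ∃ t : ℤ, (2 * p : ℤ) ∣ t ^ 2 + b := by
  obtain ⟨t, ht⟩ := h
  have hcop : IsCoprime (2 : ℤ) p := ⟨-(p / 2), 1, by omega⟩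
  have key : ∀ s : ℤ, s % 2 = 1 → (2 : ℤ) ∣ s ^ 2 + b := by
    intro s hs
    have : s ^ 2 % 2 = 1 := by rw [pow_two, Int.mul_emod, hs]; rfl
    omega
  rcases Int.emod_two_eq_zero_or_one t with h0 | h1
  · refine ⟨t + p, hcop.mul_dvd (key _ (by omega)) ?_⟩
    rw [show (t + p) ^ 2 + (b : ℤ) = t ^ 2 + b + p * (2 * t + p) by ring]
    exact dvd_add ht (dvd_mul_right _ _)
  · exact ⟨t, hcop.mul_dvd (key _ h1) ht⟩

/-- A number `N` with `q = bN - D > 0` and `-b` a square modulo `q` is a value of a positive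
definite integral ternary form of determinant `D` with first binary minor `b`. -/
theorem exists_ternaryGram {N b q D : ℤ} (hb : 0 < b) (hq : 0 < q) (h : q + D = b * N)
    (hs : ∃ t : ℤ, q ∣ t ^ 2 + b) :
    ∃ a t : ℤ, 0 < a ∧ a * q - t ^ 2 = b ∧ ternaryDet a q N 0 1 t = D := by
  obtain ⟨t, a, ha⟩ := hs
  refine ⟨a, t, ?_, by linarith, ?_⟩
  · have : 0 < q * a := by rw [← ha]; positivity
    exact (pos_iff_pos_of_mul_pos this).1 hq
  · unfold ternaryDet
    linear_combination (-N) * ha + -h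

theorem sum_three_squares_of_dvd {N b q : ℤ} (hb : 0 < b) (hq : 0 < q) (h : q + 1 = b * N)
    (hs : ∃ t : ℤ, q ∣ t ^ 2 + b) : ∃ x y z : ℤ, N = x ^ 2 + y ^ 2 + z ^ 2 := by
  obtain ⟨a, t, ha, hm, hD⟩ := exists_ternaryGram hb hq h hs
  obtain ⟨-, -, u, -, -, hu, -⟩ := (representsForm_of_det_one ha (hm ▸ hb) hD).exists_vectors
  exact ⟨u 0, u 1, u 2, by linarith⟩

theorem exists_sq_add_sq_add_five_mul_sq_of_dvd {N b q : ℤ} (hb : 0 < b) (hb5 : b % 5 = 1)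
    (hq : 0 < q) (h : q + 5 = b * N) (hs : ∃ t : ℤ, q ∣ t ^ 2 + b) :
    ∃ x y z : ℤ, N = x ^ 2 + y ^ 2 + 5 * z ^ 2 := by
  obtain ⟨a, t, ha, hm, hD⟩ := exists_ternaryGram hb hq h hs
  obtain ⟨-, -, u, -, -, hu, -⟩ :=
    (representsForm_of_det_five_of_minor ha (hm ▸ hb) hD (hm ▸ hb5)).exists_vectors
  exact ⟨u 0, u 1, u 2, by linarith⟩

theorem exists_prime_eq_mul_add {Q A : ℕ} (hQ : Q ≠ 0) (h : A.Coprime Q) :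
    ∃ p v : ℕ, p.Prime ∧ p = Q * v + A := by
  obtain ⟨p, hpA, hp, hmod⟩ := Nat.forall_exists_prime_gt_and_modEq A hQ h
  obtain ⟨v, hv⟩ := (Nat.modEq_iff_dvd' hpA.le).1 hmod.symm
  exact ⟨p, v, hp, by omega⟩

theorem coprime_four_mul {A N : ℕ} (hA : A % 2 = 1) (h : A.Coprime N) : A.Coprime (4 * N) := by
  apply Nat.Coprime.mul_right _ h
  exact Nat.Coprime.pow_right 2 (Nat.odd_iff.2 hA).coprime_two_right

open NumberTheorySymbols in
theorem sum_three_squares_of_mod_four_eq_two {N : ℕ} (hN : N % 4 = 2) :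
    ∃ x y z : ℤ, (N : ℤ) = x ^ 2 + y ^ 2 + z ^ 2 := by
  obtain ⟨A, rfl⟩ : ∃ A, N = A + 1 := ⟨N - 1, by omega⟩
  obtain ⟨p, v, hp, hpv⟩ := exists_prime_eq_mul_add (Q := 4 * (A + 1)) (A := A) (by omega)
    (coprime_four_mul (by omega) (by simp))
  have hb : p + 1 = (4 * v + 1) * (A + 1) := by rw [hpv]; ring
  have hpA : p % 4 = 1 := by
    rw [hpv, mul_assoc, Nat.mul_add_mod]; omega
  have hpo : Odd p := Nat.odd_iff.2 (by omega)
  have hJ : J(-(4 * v + 1 : ℕ) | p) = 1 := by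
    rw [jacobiSym.neg _ hpo, ZMod.χ₄_nat_one_mod_four hpA, one_mul,
      jacobiSym.quadratic_reciprocity_one_mod_four (by omega) hpo]
    have : J(p | 4 * v + 1) = J(-1 | 4 * v + 1) := by
      apply jacobiSym.mod_left'
      have : (p : ℤ) = -1 + (4 * v + 1 : ℕ) * (A + 1 : ℕ) := by
        have : (p + 1 : ℤ) = (4 * v + 1 : ℕ) * (A + 1 : ℕ) := by exact_mod_cast hb
        linarith
      rw [this, Int.add_mul_emod_self_left]
    rw [this, jacobiSym.at_neg_one (Nat.odd_iff.2 (by omega)),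
      ZMod.χ₄_nat_one_mod_four (by omega)]
  exact sum_three_squares_of_dvd (b := (4 * v + 1 : ℕ)) (q := p) (by omega)
    (by exact_mod_cast hp.pos) (by exact_mod_cast hb) (exists_dvd_sq_add_of_jacobiSym hp hJ)

open NumberTheorySymbols in
/-- The common part of the cases of odd `N`: `b = 8v + c` with `2p = bN - 1` for a prime `p`. -/
theorem sum_three_squares_of_odd {N A c : ℕ} (hA : A % 2 = 1) (h : 2 * A + 1 = c * N)
    (hAc : A % 4 = 1 ∧ c = 1 ∨ c = 3) : ∃ x y z : ℤ, (N : ℤ) = x ^ 2 + y ^ 2 + z ^ 2 := by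
  have hcop : A.Coprime N := by
    rw [← Nat.isCoprime_iff_coprime]
    have : (2 * A + 1 : ℤ) = c * N := by exact_mod_cast h
    exact ⟨-2, c, by linarith⟩
  have hN : N ≠ 0 := by rintro rfl; omega
  obtain ⟨p, v, hp, hpv⟩ := exists_prime_eq_mul_add (Q := 4 * N) (by omega)
    (coprime_four_mul hA hcop)
  have hb : 2 * p + 1 = (8 * v + c) * N := by
    rw [hpv]; linarith
  have hpA : p % 4 = A % 4 := by
    rw [hpv, mul_assoc, Nat.mul_add_mod]
  have hbo : (8 * v + c) % 2 = 1 := by omega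
  have hJ : J(-(8 * v + c : ℕ) | p) = 1 := by
    rw [jacobiSym_neg_of_two_mul_add (by omega) hbo (by omega) hb, Nat.cast_one,
      jacobiSym.at_two (Nat.odd_iff.2 hbo), jacobiSym.at_neg_one (Nat.odd_iff.2 hbo)]
    rw [ZMod.χ₈_nat_mod_eight, ZMod.χ₄_nat_mod_four]
    rcases hAc with ⟨-, rfl⟩ | rfl
    · rw [show (8 * v + 1) % 8 = 1 by omega, show (8 * v + 1) % 4 = 1 by omega]; rfl
    · rw [show (8 * v + 3) % 8 = 3 by omega, show (8 * v + 3) % 4 = 3 by omega]; rfl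
  refine sum_three_squares_of_dvd (b := (8 * v + c : ℕ)) (q := 2 * p) (by omega) ?_
    (by exact_mod_cast hb)
    (exists_two_mul_dvd_sq_add (by omega) hbo (exists_dvd_sq_add_of_jacobiSym hp hJ))
  have := hp.pos
  omega

/-- The part of the **three-square theorem** of Gauss and Legendre about numbers not divisible
by `4`. -/
theorem sum_three_squares {N : ℕ} (hN : N % 4 = 1 ∨ N % 4 = 2 ∨ N % 8 = 3) :
    ∃ x y z : ℤ, (N : ℤ) = x ^ 2 + y ^ 2 + z ^ 2 := by
  rcases hN with h | h | h
  · exact sum_three_squares_of_odd (A := (3 * N - 1) / 2) (c := 3) (by omega) (by omega) (by omega)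
  · exact sum_three_squares_of_mod_four_eq_two h
  · exact sum_three_squares_of_odd (A := (N - 1) / 2) (c := 1) (by omega) (by omega) (by omega)

open NumberTheorySymbols in
theorem exists_sq_add_sq_add_five_mul_sq_of_not_dvd {N : ℕ} (hN : N % 8 = 7) (h5 : ¬ 5 ∣ N) :
    ∃ x y z : ℤ, (N : ℤ) = x ^ 2 + y ^ 2 + 5 * z ^ 2 := by
  obtain ⟨A, rfl⟩ : ∃ A, N = A * 2 + 5 := ⟨(N - 5) / 2, by omega⟩
  have hA5 : A.Coprime 5 := by
    rw [Nat.coprime_comm, Nat.Prime.coprime_iff_not_dvd (by norm_num)]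
    omega
  have hcop : A.Coprime (5 * (A * 2 + 5)) :=
    Nat.Coprime.mul_right hA5 (by rw [Nat.coprime_mul_left_add_right]; exact hA5)
  obtain ⟨p, v, hp, hpv⟩ := exists_prime_eq_mul_add (Q := 4 * (5 * (A * 2 + 5))) (by omega)
    (coprime_four_mul (by omega) hcop)
  have hb : 2 * p + 5 = (40 * v + 1) * (A * 2 + 5) := by rw [hpv]; ring
  have hpA : p % 4 = 1 := by
    rw [hpv, mul_assoc, Nat.mul_add_mod]; omega
  have hbo : Odd (40 * v + 1) := Nat.odd_iff.2 (by omega)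
  have hJ : J(-(40 * v + 1 : ℕ) | p) = 1 := by
    rw [jacobiSym_neg_of_two_mul_add (by omega) (by omega) (by omega) hb,
      jacobiSym.neg _ hbo, jacobiSym.at_two hbo, ZMod.χ₄_nat_one_mod_four (by omega),
      jacobiSym.quadratic_reciprocity_one_mod_four (by norm_num) hbo,
      jacobiSym.mod_left, ZMod.χ₈_nat_mod_eight]
    rw [show (40 * v + 1) % 8 = 1 by omega,
      show ((40 * v + 1 : ℕ) : ℤ) % (5 : ℕ) = 1 by omega, jacobiSym.one_left]
    rfl
  refine exists_sq_add_sq_add_five_mul_sq_of_dvd (b := (40 * v + 1 : ℕ)) (q := 2 * p) (by omega)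
    (by omega) ?_ (by exact_mod_cast hb)
    (exists_two_mul_dvd_sq_add (by omega) (by omega) (exists_dvd_sq_add_of_jacobiSym hp hJ))
  have := hp.pos
  omega

/-- If `5 ∣ N`, then `N / 5 = u² + v² + w²` gives `N = (2u - v)² + (u + 2v)² + 5w²`. -/
theorem exists_sq_add_sq_add_five_mul_sq {N : ℕ} (hN : N % 8 = 7) :
    ∃ x y z : ℤ, (N : ℤ) = x ^ 2 + y ^ 2 + 5 * z ^ 2 := by
  by_cases h5 : 5 ∣ N
  · obtain ⟨M, rfl⟩ := h5
    obtain ⟨u, v, w, h⟩ := sum_three_squares (N := M) (by omega)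
    exact ⟨2 * u - v, u + 2 * v, w, by push_cast; rw [h]; ring⟩
  · exact exists_sq_add_sq_add_five_mul_sq_of_not_dvd hN h5

/-! ### Pentagonal sums -/

theorem sq_emod_cases (x : ℤ) :
    (x % 2 = 0 ∧ x ^ 2 % 4 = 0 ∨ x % 2 = 1 ∧ x ^ 2 % 8 = 1) ∧
      (x % 3 = 0 ∧ x ^ 2 % 9 = 0 ∨ x % 3 ≠ 0 ∧ x ^ 2 % 3 = 1) := by
  constructor
  · rcases Int.emod_two_eq_zero_or_one x with h | h
    · obtain ⟨k, rfl⟩ : ∃ k, x = 2 * k := ⟨x / 2, by omega⟩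
      left; ring_nf; omega
    · obtain h' | h' | h' | h' : x % 8 = 1 ∨ x % 8 = 3 ∨ x % 8 = 5 ∨ x % 8 = 7 := by omega
      all_goals right; exact ⟨h, by simp [pow_two, Int.mul_emod, h']⟩
  · obtain h | h | h : x % 3 = 0 ∨ x % 3 = 1 ∨ x % 3 = 2 := by omega
    · obtain ⟨k, rfl⟩ : ∃ k, x = 3 * k := ⟨x / 3, by omega⟩
      left; ring_nf; omega
    · right; exact ⟨by omega, by simp [pow_two, Int.mul_emod, h]⟩
    · right; exact ⟨by omega, by simp [pow_two, Int.mul_emod, h]⟩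

/-- A number represented by `y² + m z²` is so with `y, z` not both divisible by `3`, as soon as `9`
is so by `u² + m v²` with `3 ∤ u, v`: common factors `3` are cleared and then restored by
multiplication by `u ± v √-m`. -/
theorem exists_not_both_dvd_three {m u v : ℤ} (hm : 0 < m) (h9 : u ^ 2 + m * v ^ 2 = 9)
    (hu : ¬ 3 ∣ u) (hv : ¬ 3 ∣ v) (y z : ℤ) (h0 : y ^ 2 + m * z ^ 2 ≠ 0) :
    ∃ y' z' : ℤ, y' ^ 2 + m * z' ^ 2 = y ^ 2 + m * z ^ 2 ∧ ¬ (3 ∣ y' ∧ 3 ∣ z') := by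
  by_cases h : 3 ∣ y ∧ 3 ∣ z
  · obtain ⟨⟨y₁, rfl⟩, ⟨z₁, rfl⟩⟩ := h
    have hne : y₁ ≠ 0 ∨ z₁ ≠ 0 := by
      by_contra! h
      simp [h.1, h.2] at h0
    have hdec : y₁.natAbs + z₁.natAbs < (3 * y₁).natAbs + (3 * z₁).natAbs := by omega
    have h1 : y₁ ^ 2 + m * z₁ ^ 2 ≠ 0 := by
      intro h; apply h0; linear_combination 9 * h
    obtain ⟨y₂, z₂, e, hn⟩ := exists_not_both_dvd_three hm h9 hu hv y₁ z₁ h1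
    have p3 : Prime (3 : ℤ) := Int.prime_three
    by_cases hd : 3 ∣ v * y₂ + u * z₂
    · refine ⟨u * y₂ + m * v * z₂, -v * y₂ + u * z₂, ?_, ?_⟩
      · linear_combination 9 * e + (y₂ ^ 2 + m * z₂ ^ 2) * h9
      · rintro ⟨-, hd'⟩
        apply hn
        constructor
        · refine (p3.dvd_or_dvd (?_ : 3 ∣ v * y₂)).resolve_left hv
          have := dvd_sub hd hd'
          rw [show v * y₂ + u * z₂ - (-v * y₂ + u * z₂) = 2 * (v * y₂) by ring] at this
          omega
        · refine (p3.dvd_or_dvd (?_ : 3 ∣ u * z₂)).resolve_left hu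
          have := dvd_add hd hd'
          rw [show v * y₂ + u * z₂ + (-v * y₂ + u * z₂) = 2 * (u * z₂) by ring] at this
          omega
    · refine ⟨u * y₂ - m * v * z₂, v * y₂ + u * z₂, ?_, fun h => hd h.2⟩
      linear_combination 9 * e + (y₂ ^ 2 + m * z₂ ^ 2) * h9
  · exact ⟨y, z, rfl, h⟩
termination_by y.natAbs + z.natAbs

theorem exists_sq_add_two_mul_sq_not_dvd_three {y z : ℤ} (h0 : y ^ 2 + 2 * z ^ 2 ≠ 0)
    (h : (y ^ 2 + 2 * z ^ 2) % 3 = 0) :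
    ∃ y' z' : ℤ, y' ^ 2 + 2 * z' ^ 2 = y ^ 2 + 2 * z ^ 2 ∧ y' % 3 ≠ 0 ∧ z' % 3 ≠ 0 := by
  obtain ⟨y', z', e, hn⟩ := exists_not_both_dvd_three (m := 2) (u := 1) (v := 2)
    (by norm_num) (by norm_num) (by norm_num) (by norm_num) y z h0
  have := (sq_emod_cases y').2
  have := (sq_emod_cases z').2
  exact ⟨y', z', e, by omega, by omega⟩

theorem exists_sq_add_five_mul_sq_not_dvd_three {y z : ℤ} (h0 : y ^ 2 + 5 * z ^ 2 ≠ 0)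
    (h : (y ^ 2 + 5 * z ^ 2) % 3 = 0) :
    ∃ y' z' : ℤ, y' ^ 2 + 5 * z' ^ 2 = y ^ 2 + 5 * z ^ 2 ∧ y' % 3 ≠ 0 ∧ z' % 3 ≠ 0 := by
  obtain ⟨y', z', e, hn⟩ := exists_not_both_dvd_three (m := 5) (u := 2) (v := 1)
    (by norm_num) (by norm_num) (by norm_num) (by norm_num) y z h0
  have := (sq_emod_cases y').2
  have := (sq_emod_cases z').2
  exact ⟨y', z', e, by omega, by omega⟩

/-- A nonzero sum of three squares is one of squares not all divisible by `3`. A common factor `3`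
is cleared and restored by three times the reflection in `(1, 1, 1)`, after a change of signs that
makes `x + y + z` prime to `3`. -/
theorem exists_three_squares_not_all_dvd_three (x y z : ℤ) (h0 : x ^ 2 + y ^ 2 + z ^ 2 ≠ 0) :
    ∃ x' y' z' : ℤ, x' ^ 2 + y' ^ 2 + z' ^ 2 = x ^ 2 + y ^ 2 + z ^ 2 ∧
      ¬ (3 ∣ x' ∧ 3 ∣ y' ∧ 3 ∣ z') := by
  by_cases h : 3 ∣ x ∧ 3 ∣ y ∧ 3 ∣ z
  · obtain ⟨⟨x₁, rfl⟩, ⟨y₁, rfl⟩, ⟨z₁, rfl⟩⟩ := h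
    have hne : x₁ ≠ 0 ∨ y₁ ≠ 0 ∨ z₁ ≠ 0 := by
      by_contra! h
      simp [h.1, h.2.1, h.2.2] at h0
    have hdec : x₁.natAbs + y₁.natAbs + z₁.natAbs
        < (3 * x₁).natAbs + (3 * y₁).natAbs + (3 * z₁).natAbs := by omega
    have h1 : x₁ ^ 2 + y₁ ^ 2 + z₁ ^ 2 ≠ 0 := by
      intro h; apply h0; linear_combination 9 * h
    obtain ⟨x₂, y₂, z₂, e, hn⟩ := exists_three_squares_not_all_dvd_three x₁ y₁ z₁ h1
    obtain ⟨x₃, y₃, z₃, e', hs⟩ : ∃ x₃ y₃ z₃ : ℤ,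
        x₃ ^ 2 + y₃ ^ 2 + z₃ ^ 2 = x₂ ^ 2 + y₂ ^ 2 + z₂ ^ 2 ∧ ¬ 3 ∣ x₃ + y₃ + z₃ := by
      by_cases hx : 3 ∣ x₂ + y₂ + z₂
      · by_cases hx' : 3 ∣ x₂
        · exact ⟨x₂, -y₂, z₂, by ring, by omega⟩
        · exact ⟨-x₂, y₂, z₂, by ring, by omega⟩
      · exact ⟨x₂, y₂, z₂, rfl, hx⟩
    refine ⟨x₃ - 2 * y₃ - 2 * z₃, y₃ - 2 * x₃ - 2 * z₃, z₃ - 2 * x₃ - 2 * y₃, ?_, by omega⟩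
    linear_combination 9 * e + 9 * e'
  · exact ⟨x, y, z, rfl, h⟩
termination_by x.natAbs + y.natAbs + z.natAbs

theorem exists_pentagonal_eq {X : ℤ} (h2 : X % 2 = 1) (h3 : X % 3 ≠ 0) :
    ∃ x : ℤ, X ^ 2 = 24 * polygonal 5 x + 1 := by
  obtain h | h : X % 6 = 1 ∨ X % 6 = 5 := by omega
  · obtain ⟨k, rfl⟩ : ∃ k, X = 1 - 6 * k := ⟨(1 - X) / 6, by omega⟩
    have := two_mul_polygonal 5 k
    push_cast at this
    exact ⟨k, by linear_combination (-12) * this⟩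
  · obtain ⟨k, rfl⟩ : ∃ k, X = 6 * k - 1 := ⟨(X + 1) / 6, by omega⟩
    have := two_mul_polygonal 5 k
    push_cast at this
    exact ⟨k, by linear_combination (-12) * this⟩

/-- Completing squares: as `24 p₅(x) + 1 = (6x - 1)²`, a sum of three pentagonal numbers is
universal when `a X² + b Y² + c Z²`, with `X, Y, Z` prime to `6`, represents all
`24 n + a + b + c`. -/
theorem universalOverInt_pentagonal {a b c : ℕ}
    (h : ∀ n : ℕ, ∃ X Y Z : ℤ, 24 * (n : ℤ) + a + b + c = a * X ^ 2 + b * Y ^ 2 + c * Z ^ 2 ∧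
      (X % 2 = 1 ∧ Y % 2 = 1 ∧ Z % 2 = 1) ∧ X % 3 ≠ 0 ∧ Y % 3 ≠ 0 ∧ Z % 3 ≠ 0) :
    UniversalOverInt a 5 b 5 c 5 := by
  have nonneg : ∀ x : ℤ, 0 ≤ polygonal 5 x := by
    intro x
    have h := two_mul_polygonal 5 x
    push_cast at h
    rcases le_or_gt x 0 with hx | hx <;> nlinarith
  ext n
  constructor
  · rintro ⟨x, y, z, rfl⟩
    have hx := nonneg x
    have hy := nonneg y
    have hz := nonneg z
    exact Int.eq_ofNat_of_zero_le (by positivity) |>.imp fun _ h => h.symm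
  · rintro ⟨n, rfl⟩
    obtain ⟨X, Y, Z, e, ⟨hX, hY, hZ⟩, hX3, hY3, hZ3⟩ := h n
    obtain ⟨x, hx⟩ := exists_pentagonal_eq hX hX3
    obtain ⟨y, hy⟩ := exists_pentagonal_eq hY hY3
    obtain ⟨z, hz⟩ := exists_pentagonal_eq hZ hZ3
    refine ⟨x, y, z, ?_⟩
    rw [hx, hy, hz] at e
    linarith

theorem universalOverInt_pentagonal_one_one_two : UniversalOverInt 1 5 1 5 2 5 := by
  refine universalOverInt_pentagonal fun n => ?_
  obtain ⟨x, y, z, e⟩ := sum_three_squares (N := 12 * n + 2) (by omega)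
  push_cast at e
  obtain ⟨u, v, w, e, hw, hw3, huv, huv3⟩ : ∃ u v w : ℤ, 12 * (n : ℤ) + 2 = u ^ 2 + v ^ 2 + w ^ 2 ∧
      w % 2 = 1 ∧ w % 3 ≠ 0 ∧ (u + v) % 2 = 1 ∧ (u % 3 = 0 ∧ v % 3 ≠ 0 ∨ u % 3 ≠ 0 ∧ v % 3 = 0) := by
    have hx := sq_emod_cases x
    have hy := sq_emod_cases y
    have hz := sq_emod_cases z
    by_cases h1 : z % 2 = 1 ∧ z % 3 ≠ 0
    · exact ⟨x, y, z, e, by omega⟩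
    by_cases h2 : y % 2 = 1 ∧ y % 3 ≠ 0
    · exact ⟨x, z, y, by linarith, by omega⟩
    · exact ⟨y, z, x, by linarith, by omega⟩
  exact ⟨u + v, u - v, w, by push_cast; linear_combination 2 * e, by omega⟩

theorem universalOverInt_pentagonal_one_one_four : UniversalOverInt 1 5 1 5 4 5 := by
  refine universalOverInt_pentagonal fun n => ?_
  obtain ⟨x, y, z, e⟩ := sum_three_squares (N := 24 * n + 6) (by omega)
  push_cast at e
  obtain ⟨x, y, z, e', h3⟩ := exists_three_squares_not_all_dvd_three x y z (by omega)
  rw [← e'] at e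
  obtain ⟨u, v, w, e, huv, h3⟩ : ∃ u v w : ℤ, 24 * (n : ℤ) + 6 = u ^ 2 + v ^ 2 + (2 * w) ^ 2 ∧
      (u % 2 = 1 ∧ v % 2 = 1) ∧ u % 3 ≠ 0 ∧ v % 3 ≠ 0 ∧ w % 3 ≠ 0 := by
    have hx := sq_emod_cases x
    have hy := sq_emod_cases y
    have hz := sq_emod_cases z
    obtain h | h | h : x % 2 = 0 ∨ y % 2 = 0 ∨ z % 2 = 0 := by omega
    · exact ⟨y, z, x / 2, by rw [Int.mul_ediv_cancel' (by omega)]; linarith, by omega⟩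
    · exact ⟨x, z, y / 2, by rw [Int.mul_ediv_cancel' (by omega)]; linarith, by omega⟩
    · exact ⟨x, y, z / 2, by rw [Int.mul_ediv_cancel' (by omega)]; linarith, by omega⟩
  have hu := (sq_emod_cases u).1
  have hv := (sq_emod_cases v).1
  have hw := (sq_emod_cases w).1
  rw [mul_pow] at e
  exact ⟨u, v, w, by push_cast; linear_combination e, by omega, h3⟩

/-- A representation `N = x² + 4u² + 4v²` with `3 ∤ x` and `3 ∣ v`. If `3 ∣ x` at first, then
`N = x² + 2(u - v)² + 2(u + v)²`, where up to the sign of `v` also `3 ∣ u - v`, and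
`x² + 2(u - v)²` is rewritten with both squares prime to `3`. -/
theorem exists_sq_add_four_mul_sq_add_sq {N : ℕ} (hN : N % 12 = 5) :
    ∃ x u v : ℤ, (N : ℤ) = x ^ 2 + 4 * u ^ 2 + 4 * v ^ 2 ∧
      x % 2 = 1 ∧ x % 3 ≠ 0 ∧ u % 3 ≠ 0 ∧ v % 3 = 0 := by
  obtain ⟨x, y, z, e⟩ := sum_three_squares (N := N) (by omega)
  obtain ⟨x, u, v, e, hx⟩ : ∃ x u v : ℤ, (N : ℤ) = x ^ 2 + (2 * u) ^ 2 + (2 * v) ^ 2 ∧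
      x % 2 = 1 := by
    have hx := (sq_emod_cases x).1
    have hy := (sq_emod_cases y).1
    have hz := (sq_emod_cases z).1
    obtain h | h | h : x % 2 = 1 ∧ y % 2 = 0 ∧ z % 2 = 0 ∨ y % 2 = 1 ∧ x % 2 = 0 ∧ z % 2 = 0 ∨
      z % 2 = 1 ∧ x % 2 = 0 ∧ y % 2 = 0 := by omega
    · refine ⟨x, y / 2, z / 2, ?_, h.1⟩
      rw [Int.mul_ediv_cancel' (by omega), Int.mul_ediv_cancel' (by omega)]; linarith
    · refine ⟨y, x / 2, z / 2, ?_, h.1⟩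
      rw [Int.mul_ediv_cancel' (by omega), Int.mul_ediv_cancel' (by omega)]; linarith
    · refine ⟨z, x / 2, y / 2, ?_, h.1⟩
      rw [Int.mul_ediv_cancel' (by omega), Int.mul_ediv_cancel' (by omega)]; linarith
  rw [mul_pow, mul_pow] at e
  norm_num only at e
  have hx' := sq_emod_cases x
  have hu' := (sq_emod_cases u).2
  have hv' := (sq_emod_cases v).2
  by_cases hx3 : x % 3 = 0
  · obtain ⟨w, ew, hw3⟩ : ∃ w : ℤ, w ^ 2 = v ^ 2 ∧ (u - w) % 3 = 0 := by
      have hu3 : u % 3 = 1 ∨ u % 3 = 2 := by omega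
      have hv3 : v % 3 = 1 ∨ v % 3 = 2 := by omega
      by_cases h : (u - v) % 3 = 0
      · exact ⟨v, rfl, h⟩
      · refine ⟨-v, by ring, ?_⟩
        clear e hx' hu' hv'
        omega
    have e1 : (N : ℤ) = x ^ 2 + 2 * (u - w) ^ 2 + 2 * (u + w) ^ 2 := by
      linear_combination e - 4 * ew
    have hd := sq_emod_cases (u - w)
    have hd0 := sq_nonneg (u - w)
    have hx0 := sq_nonneg x
    obtain ⟨x', d, e2, hx3', hd3⟩ := exists_sq_add_two_mul_sq_not_dvd_three
      (y := x) (z := u - w) (by omega) (by omega)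
    have hx'' := (sq_emod_cases x').1
    have hd' := (sq_emod_cases d).1
    have hw' := (sq_emod_cases w).2
    have hs : (u + w) % 3 ≠ 0 := by omega
    have hpar : d % 2 = (u + w) % 2 := by omega
    obtain ⟨f, hf⟩ : ∃ f, u + w = 2 * f - d := ⟨(u + w + d) / 2, by omega⟩
    rw [hf] at e1
    by_cases h3 : f % 3 = 0
    · refine ⟨x', f - d, f, ?_, by omega⟩
      linear_combination e1 - e2
    · have hfd : (f - d) % 3 = 0 := by
        have hd3' : d % 3 = 1 ∨ d % 3 = 2 := by omega
        have hf3' : f % 3 = 1 ∨ f % 3 = 2 := by omega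
        have hs' : (2 * f - d) % 3 ≠ 0 := hf ▸ hs
        clear hx' hu' hv' hd hd0 hx0 e1 e2 hx'' hd' hw' hs hpar hf e ew
        omega
      refine ⟨x', f, f - d, ?_, by omega, hx3', h3, hfd⟩
      linear_combination e1 - e2
  · by_cases hu3 : u % 3 = 0
    · exact ⟨x, v, u, by linarith, by omega⟩
    · exact ⟨x, u, v, by linarith, by omega⟩

theorem universalOverInt_pentagonal_one_two_two : UniversalOverInt 1 5 2 5 2 5 := by
  refine universalOverInt_pentagonal fun n => ?_
  obtain ⟨x, u, v, e, hx, hx3, hu3, hv3⟩ :=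
    exists_sq_add_four_mul_sq_add_sq (N := 24 * n + 5) (by omega)
  push_cast at e
  have hx' := (sq_emod_cases x).1
  have hu' := (sq_emod_cases u).1
  have hv' := (sq_emod_cases v).1
  exact ⟨x, u + v, u - v, by push_cast; linear_combination e, by omega⟩

theorem universalOverInt_pentagonal_one_two_four : UniversalOverInt 1 5 2 5 4 5 := by
  refine universalOverInt_pentagonal fun n => ?_
  obtain ⟨x, y, z, e⟩ := sum_three_squares (N := 48 * n + 14) (by omega)
  push_cast at e
  -- `2 (x² + 2y² + 4z²) = (x + 2z)² + (x - 2z)² + (2y)²`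
  obtain ⟨x, y, z, e⟩ : ∃ x y z : ℤ, 24 * (n : ℤ) + 7 = x ^ 2 + 2 * y ^ 2 + 4 * z ^ 2 := by
    have key : ∀ a b c : ℤ, 48 * (n : ℤ) + 14 = a ^ 2 + b ^ 2 + c ^ 2 → c % 2 = 0 → a % 2 = 1 →
        b % 2 = 1 → ∃ x y z : ℤ, 24 * (n : ℤ) + 7 = x ^ 2 + 2 * y ^ 2 + 4 * z ^ 2 := by
      intro a b c e hc ha hb
      obtain ⟨b', eb, hb'⟩ : ∃ b' : ℤ, b' ^ 2 = b ^ 2 ∧ (a - b') % 4 = 0 := by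
        by_cases h : (a - b) % 4 = 0
        · exact ⟨b, rfl, h⟩
        · exact ⟨-b, by ring, by omega⟩
      obtain ⟨z, hz⟩ : ∃ z, a = b' + 4 * z := ⟨(a - b') / 4, by omega⟩
      obtain ⟨y, hy⟩ : ∃ y, c = 2 * y := ⟨c / 2, by omega⟩
      refine ⟨b' + 2 * z, y, z, ?_⟩
      rw [← eb, hz, hy] at e
      linarith
    have hx := (sq_emod_cases x).1
    have hy := (sq_emod_cases y).1
    have hz := (sq_emod_cases z).1
    obtain h | h | h : x % 2 = 0 ∨ y % 2 = 0 ∨ z % 2 = 0 := by omega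
    · exact key y z x (by linarith) h (by omega) (by omega)
    · exact key x z y (by linarith) h (by omega) (by omega)
    · exact key x y z (by linarith) h (by omega) (by omega)
  have odd : ∀ x y z : ℤ, 24 * (n : ℤ) + 7 = x ^ 2 + 2 * y ^ 2 + 4 * z ^ 2 →
      x % 2 = 1 ∧ y % 2 = 1 ∧ z % 2 = 1 := by
    intro x y z e
    have hx := (sq_emod_cases x).1
    have hy := (sq_emod_cases y).1
    have hz := (sq_emod_cases z).1
    omega
  have hx := sq_emod_cases x
  have hy := sq_emod_cases y
  have hz := sq_emod_cases z
  have hxyz := odd x y z e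
  have hx0 := sq_nonneg x
  have hy0 := sq_nonneg y
  have hz0 := sq_nonneg z
  obtain h | h | h : x % 3 ≠ 0 ∧ y % 3 ≠ 0 ∧ z % 3 ≠ 0 ∨ x % 3 ≠ 0 ∧ y % 3 = 0 ∧ z % 3 = 0 ∨
    z % 3 ≠ 0 ∧ x % 3 = 0 ∧ y % 3 = 0 := by omega
  · exact ⟨x, y, z, by push_cast; linarith, hxyz, h⟩
  · obtain ⟨y', z', e', hy', hz'⟩ := exists_sq_add_two_mul_sq_not_dvd_three
      (y := y) (z := z) (by omega) (by omega)
    exact ⟨x, y', z', by push_cast; linarith, odd _ _ _ (by linarith), h.1, hy', hz'⟩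
  · obtain ⟨x', y', e', hx', hy'⟩ := exists_sq_add_two_mul_sq_not_dvd_three
      (y := x) (z := y) (by omega) (by omega)
    exact ⟨x', y', z, by push_cast; linarith, odd _ _ _ (by linarith), hx', hy', h.1⟩

theorem universalOverInt_pentagonal_one_one_five : UniversalOverInt 1 5 1 5 5 5 := by
  refine universalOverInt_pentagonal fun n => ?_
  obtain ⟨x, y, z, e⟩ := exists_sq_add_sq_add_five_mul_sq (N := 24 * n + 7) (by omega)
  push_cast at e
  have odd : ∀ x y z : ℤ, 24 * (n : ℤ) + 7 = x ^ 2 + y ^ 2 + 5 * z ^ 2 →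
      x % 2 = 1 ∧ y % 2 = 1 ∧ z % 2 = 1 := by
    intro x y z e
    have hx := (sq_emod_cases x).1
    have hy := (sq_emod_cases y).1
    have hz := (sq_emod_cases z).1
    omega
  have hx := sq_emod_cases x
  have hy := sq_emod_cases y
  have hz := sq_emod_cases z
  have hxyz := odd x y z e
  have hx0 := sq_nonneg x
  have hy0 := sq_nonneg y
  have hz0 := sq_nonneg z
  obtain h | h | h : x % 3 ≠ 0 ∧ y % 3 ≠ 0 ∧ z % 3 ≠ 0 ∨ x % 3 ≠ 0 ∧ y % 3 = 0 ∧ z % 3 = 0 ∨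
    y % 3 ≠ 0 ∧ x % 3 = 0 ∧ z % 3 = 0 := by omega
  · exact ⟨x, y, z, by push_cast; linarith, hxyz, h⟩
  · obtain ⟨y', z', e', hy', hz'⟩ := exists_sq_add_five_mul_sq_not_dvd_three
      (y := y) (z := z) (by omega) (by omega)
    exact ⟨x, y', z', by push_cast; linarith, odd _ _ _ (by linarith), h.1, hy', hz'⟩
  · obtain ⟨x', z', e', hx', hz'⟩ := exists_sq_add_five_mul_sq_not_dvd_three
      (y := x) (z := z) (by omega) (by omega)
    exact ⟨x', y, z', by push_cast; linarith, odd _ _ _ (by linarith), hx', h.1, hz'⟩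

/-- Doubling `12 n + 5 = a² + 4u² + 36w²` gives `X² + 9 (s² + 8w²)`, where `3s = a ± 2u` is the
factor of `a² - 4u²` divisible by `3`. Then `3 (s² + 8w²)` is the norm of
`(1 + √-2) (s + 2w √-2)`. -/
theorem universalOverInt_pentagonal_one_three_six : UniversalOverInt 1 5 3 5 6 5 := by
  refine universalOverInt_pentagonal fun n => ?_
  obtain ⟨a, u, v, e, ha, ha3, hu3, hv3⟩ :=
    exists_sq_add_four_mul_sq_add_sq (N := 12 * n + 5) (by omega)
  push_cast at e
  obtain ⟨u', eu, hu'⟩ : ∃ u' : ℤ, u' ^ 2 = u ^ 2 ∧ (a - 2 * u') % 3 = 0 := by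
    have ha3' : a % 3 = 1 ∨ a % 3 = 2 := by omega
    have hu3' : u % 3 = 1 ∨ u % 3 = 2 := by omega
    by_cases h : (a - 2 * u) % 3 = 0
    · exact ⟨u, rfl, h⟩
    · exact ⟨-u, by ring, by omega⟩
  obtain ⟨s, hs⟩ : ∃ s, a = 2 * u' + 3 * s := ⟨(a - 2 * u') / 3, by omega⟩
  obtain ⟨w, rfl⟩ : ∃ w, v = 3 * w := ⟨v / 3, by omega⟩
  have hs2 : s % 2 = 1 := by omega
  have e1 : (s - 4 * w) ^ 2 + 2 * (s + 2 * w) ^ 2 = 3 * (s ^ 2 + 8 * w ^ 2) := by ring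
  have h1 := (sq_emod_cases (s - 4 * w)).1
  have h2 := (sq_emod_cases (s + 2 * w)).1
  obtain ⟨y, z, e2, hy3, hz3⟩ := exists_sq_add_two_mul_sq_not_dvd_three
    (y := s - 4 * w) (z := s + 2 * w) (by omega) (by omega)
  have hy := (sq_emod_cases y).1
  have hz := (sq_emod_cases z).1
  refine ⟨a + 2 * u', y, z, ?_, by omega, by omega, hy3, hz3⟩
  push_cast
  rw [hs] at e ⊢
  linear_combination 2 * e - 8 * eu - 3 * e1 - 3 * e2

theorem theorem1p1 :
    (∀ k a b c : ℕ, 4 ≤ k → k ≠ 6 → 1 ≤ a → a ≤ b → b ≤ c →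
      UniversalOverInt a k b k c k →
      k = 5 ∧
        (a, b, c) ∈ ({(1, 1, 1), (1, 1, 2), (1, 1, 3), (1, 1, 4), (1, 1, 5), (1, 1, 6),
          (1, 1, 8), (1, 1, 9), (1, 1, 10),
          (1, 2, 2), (1, 2, 3), (1, 2, 4), (1, 2, 6), (1, 2, 8),
          (1, 3, 3), (1, 3, 4), (1, 3, 6), (1, 3, 7), (1, 3, 8), (1, 3, 9)} :
          Set (ℕ × ℕ × ℕ))) ∧
    (UniversalOverInt 1 5 1 5 2 5 ∧
      UniversalOverInt 1 5 1 5 4 5 ∧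
      UniversalOverInt 1 5 2 5 2 5 ∧
      UniversalOverInt 1 5 2 5 4 5 ∧
      UniversalOverInt 1 5 1 5 5 5 ∧
      UniversalOverInt 1 5 3 5 6 5) := by
  refine ⟨fun k a b c hk hk6 ha hab hbc h => ?_, universalOverInt_pentagonal_one_one_two,
    universalOverInt_pentagonal_one_one_four, universalOverInt_pentagonal_one_two_two,
    universalOverInt_pentagonal_one_two_four, universalOverInt_pentagonal_one_one_five,
    universalOverInt_pentagonal_one_three_six⟩
  have hk5 : k = 5 := by
    by_contra hk5
    rcases le_or_gt k 11 with h11 | h12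
    · exact not_universalOverInt_of_le_eleven hk hk5 hk6 h11 ha hab hbc h
    · exact not_universalOverInt_of_twelve_le h12 ha hab hbc h
  subst hk5
  exact ⟨rfl, h.pentagonal_coeff_mem ha hab hbc⟩
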